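/- Let $\rho,\alpha>0$. For $a,b\ge 0$ consider the system, for real functions $U,V$ on $\mathbb{R}$, $$\begin{cases} U''-U^3-\alpha (V+\rho)U=0,\\ (aV^2-bV^3)'=\alpha (U^2)', \end{cases}\qquad\text{in } \mathbb{R},\tag{S}$$ understood in the weak (distributional) sense. Let $H^1_{rd}(\mathbb{R})$ be the set of functions in $H^1(\mathbb{R})$ (taken with their continuous representative) which are even and decreasing (that is, nonincreasing) with respect to $|x|$. Then: 1. If $a=0$, there exists $b>0$ such that (S) admits a solution $(U,V)$ with $U\in H^1_{rd}(\mathbb{R})$, $U>0$ in $\mathbb{R}$, and $V(x)=-\left(\frac{\alpha}{b}\right)^{1/3}U^{2/3}(x)$. 2. If $b=0$, there exists $a>0$ such that (S) admits a solution $(U,V)$ with $U\in H^1_{rd}(\mathbb{R})$, $U>0$ in $\mathbb{R}$, and $V(x)=-\left(\frac{\alpha}{a}\right)^{1/2}U(x)$. 3. There exist $a,b>0$ such that (S) admits a solution $(U,V)$ with $U\in H^1_{rd}(\mathbb{R})$, $U>0$ and $V<0$ in $\mathbb{R}$, and $aV^2-bV^3=\alpha U^2$ in $\mathbb{R}$.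 -/

import Mathlib

open MeasureTheory Set
open scoped ContDiff

/-- `g` is the weak (distributional) derivative of `f` on the real line: both are locally
integrable and `∫ f φ' = - ∫ g φ` for every real test function `φ` that is smooth with compact
support. -/
def HasWeakDeriv (f g : ℝ → ℝ) : Prop :=
  LocallyIntegrable f ∧ LocallyIntegrable g ∧
    ∀ φ : ℝ → ℝ, ContDiff ℝ ∞ φ → HasCompactSupport φ →
      ∫ x, f x * deriv φ x = - ∫ x, g x * φ x

/-- The Sobolev space `H¹(ℝ)` of real functions: `U` is square integrable and has a square
integrable weak derivative. -/
def MemH1 (U : ℝ → ℝ) : Prop :=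
  MemLp U 2 ∧ ∃ U' : ℝ → ℝ, HasWeakDeriv U U' ∧ MemLp U' 2

/-- `H¹_rd(ℝ)`: the elements of `H¹(ℝ)`, given by their continuous representative, that are even
and decreasing (i.e. nonincreasing) with respect to `|x|`. -/
def MemH1rd (U : ℝ → ℝ) : Prop :=
  MemH1 U ∧ Continuous U ∧ Function.Even U ∧ ∀ x y : ℝ, |x| ≤ |y| → U y ≤ U x

/-- `(U, V)` is a (weak) solution of the standing-wave system
`U'' - U³ - α (V + ρ) U = 0`, `(a V² - b V³)' = α (U²)'` on the real line.
The first equation says that the weak second derivative of `U` is `U³ + α (V + ρ) U`; the second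
one is the equality of the distributional derivatives of two locally integrable functions. -/
def IsStandingWave (ρ α a b : ℝ) (U V : ℝ → ℝ) : Prop :=
  (∃ U' : ℝ → ℝ, HasWeakDeriv U U' ∧
    HasWeakDeriv U' (fun x => U x ^ 3 + α * (V x + ρ) * U x)) ∧
  LocallyIntegrable (fun x => a * V x ^ 2 - b * V x ^ 3) ∧
  LocallyIntegrable (fun x => U x ^ 2) ∧
  ∀ φ : ℝ → ℝ, ContDiff ℝ ∞ φ → HasCompactSupport φ →
    ∫ x, (a * V x ^ 2 - b * V x ^ 3) * deriv φ x = α * ∫ x, U x ^ 2 * deriv φ x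

theorem hasWeakDeriv_of_hasDerivAt {f g : ℝ → ℝ} (hf : ∀ x, HasDerivAt f (g x) x)
    (hg : Continuous g) : HasWeakDeriv f g := by
  have hfc : Continuous f := continuous_iff_continuousAt.2 fun x => (hf x).continuousAt
  refine ⟨hfc.locallyIntegrable, hg.locallyIntegrable, fun φ hφ hs => ?_⟩
  have hφd : Differentiable ℝ φ := hφ.differentiable (by simp)
  have hφ' : Continuous (deriv φ) := hφ.continuous_deriv (by simp)
  exact integral_mul_deriv_eq_deriv_mul_of_integrable (fun x _ => hf x)
    (fun x _ => (hφd x).hasDerivAt)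
    ((hfc.mul hφ').integrable_of_hasCompactSupport hs.deriv.mul_left)
    ((hg.mul hφ.continuous).integrable_of_hasCompactSupport hs.mul_left)
    ((hfc.mul hφ.continuous).integrable_of_hasCompactSupport hs.mul_left)

/-- The scalar autonomous equation `θ' = σ(θ)` with an even speed between two positive constants
has an odd increasing solution. -/
theorem exists_odd_solution {σ : ℝ → ℝ} {c C : ℝ} (hσ : Continuous σ) (heven : ∀ s, σ (-s) = σ s)
    (hc : 0 < c) (hcσ : ∀ s, c ≤ σ s) (hσC : ∀ s, σ s ≤ C) :
    ∃ θ : ℝ → ℝ, (∀ x, HasDerivAt θ (σ (θ x)) x) ∧ StrictMono θ ∧ (∀ x, θ (-x) = -θ x) ∧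
      ∀ x, c * |x| ≤ |θ x| := by
  have hpos : ∀ s, 0 < σ s := fun s => hc.trans_le (hcσ s)
  have hC : 0 < C := (hpos 0).trans_le (hσC 0)
  have hinv : Continuous fun s => (σ s)⁻¹ := hσ.inv₀ fun s => (hpos s).ne'
  set Φ : ℝ → ℝ := fun s => ∫ t in (0 : ℝ)..s, (σ t)⁻¹ with hΦ
  have hΦd : ∀ s, HasDerivAt Φ (σ s)⁻¹ s := fun s =>
    intervalIntegral.integral_hasDerivAt_right (hinv.intervalIntegrable _ _)
      (hinv.stronglyMeasurableAtFilter _ _) hinv.continuousAt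
  have hmono : StrictMono Φ :=
    strictMono_of_hasDerivAt_pos hΦd fun s => inv_pos.2 (hpos s)
  have hΦ0 : Φ 0 = 0 := by simp [hΦ]
  have hodd : ∀ s, Φ (-s) = -Φ s := by
    intro s
    have h := intervalIntegral.integral_comp_neg (a := 0) (b := s) fun t => (σ t)⁻¹
    simp only [heven, neg_zero] at h
    simp only [hΦ]
    rw [h, intervalIntegral.integral_symm]
  have hlow : ∀ s, 0 ≤ s → C⁻¹ * s ≤ Φ s := by
    intro s hs
    have := mul_sub_le_image_sub_of_le_deriv (f := Φ) (C := C⁻¹)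
      (fun s => (hΦd s).differentiableAt)
      (fun s => by rw [(hΦd s).deriv]; exact inv_anti₀ (hpos s) (hσC s)) hs
    simpa [hΦ0] using this
  have hΦc : Continuous Φ := continuous_iff_continuousAt.2 fun s => (hΦd s).continuousAt
  have htop : Filter.Tendsto Φ Filter.atTop Filter.atTop :=
    Filter.tendsto_atTop_mono' _
      ((Filter.eventually_ge_atTop 0).mono hlow)
      (Filter.tendsto_id.const_mul_atTop (inv_pos.2 hC))
  have hbot : Filter.Tendsto Φ Filter.atBot Filter.atBot := by
    have h := Filter.tendsto_neg_atTop_atBot.comp (htop.comp Filter.tendsto_neg_atBot_atTop)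
    refine h.congr fun s => ?_
    simp [hodd]
  have hsurj : Function.Surjective Φ := hΦc.surjective htop hbot
  let e : ℝ ≃o ℝ := hmono.orderIsoOfSurjective Φ hsurj
  have he : ∀ x, Φ (e.symm x) = x := fun x => e.apply_symm_apply x
  have hθd : ∀ x, HasDerivAt e.symm (σ (e.symm x)) x := by
    intro x
    have := HasDerivAt.of_local_left_inverse (f := Φ) (g := e.symm) (a := x)
      e.symm.continuous.continuousAt (hΦd _) (inv_ne_zero (hpos _).ne')
      (Filter.Eventually.of_forall he)
    simpa using this
  have hθodd : ∀ x, e.symm (-x) = -e.symm x := by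
    intro x
    apply hmono.injective
    rw [he, hodd, he]
  have hθ0 : e.symm 0 = 0 := hmono.injective (by rw [he, hΦ0])
  have hθlow : ∀ x, 0 ≤ x → c * x ≤ e.symm x := by
    intro x hx
    have := mul_sub_le_image_sub_of_le_deriv (f := e.symm) (C := c)
      (fun s => (hθd s).differentiableAt)
      (fun s => by rw [(hθd s).deriv]; exact hcσ _) hx
    simpa [hθ0] using this
  refine ⟨e.symm, hθd, e.symm.strictMono, hθodd, fun x => ?_⟩
  rcases le_total 0 x with hx | hx
  · rw [abs_of_nonneg hx]
    exact (hθlow x hx).trans (le_abs_self _)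
  · rw [abs_of_nonpos hx]
    refine (hθlow (-x) (by linarith)).trans ?_
    rw [hθodd]
    exact neg_le_abs _

theorem integrable_inv_cosh_sq {θ : ℝ → ℝ} {c : ℝ} (hc : 0 < c) (hθ : Continuous θ)
    (hcθ : ∀ x, c * |x| ≤ |θ x|) : Integrable fun x => (Real.cosh (θ x) ^ 2)⁻¹ := by
  have h1 : Integrable fun x : ℝ => (1 + (c * x) ^ 2)⁻¹ :=
    (integrable_comp_mul_left_iff (fun x : ℝ => (1 + x ^ 2)⁻¹) hc.ne').2 integrable_inv_one_add_sq
  refine h1.mono' ?_ (Filter.Eventually.of_forall fun x => ?_)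
  · exact (Continuous.inv₀ (by fun_prop) fun x => by positivity).aestronglyMeasurable
  · rw [Real.norm_of_nonneg (by positivity)]
    refine inv_anti₀ (by positivity) ?_
    rw [← Real.cosh_abs, Real.cosh_sq, add_comm, add_le_add_iff_right, ← sq_abs (c * x), abs_mul,
      abs_of_pos hc]
    gcongr
    exact (hcθ x).trans (Real.self_le_sinh_iff.2 (abs_nonneg _))

theorem memLp_two_of_abs_le_mul {f v : ℝ → ℝ} {K M : ℝ} (hf : Continuous f) (hv : Integrable v)
    (hv0 : ∀ x, 0 ≤ v x) (hvM : ∀ x, v x ≤ M) (hfv : ∀ x, |f x| ≤ K * v x) : MemLp f 2 := by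
  rw [memLp_two_iff_integrable_sq hf.aestronglyMeasurable]
  refine (hv.const_mul (K ^ 2 * M)).mono' (hf.pow 2).aestronglyMeasurable
    (Filter.Eventually.of_forall fun x => ?_)
  rw [Real.norm_of_nonneg (sq_nonneg _), ← sq_abs]
  calc |f x| ^ 2 ≤ (K * v x) ^ 2 := by gcongr; exact hfv x
    _ = K ^ 2 * v x * v x := by ring
    _ ≤ K ^ 2 * v x * M := by
        have := hvM x
        have := hv0 x
        gcongr
    _ = K ^ 2 * M * v x := by ring

/-- A homoclinic orbit of `u'' = N`, written in a coordinate `v` with `u = g v` and with energy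
`(u') ^ 2 = 2 v ^ 2 (m - v) R v`, whose turning point is `v = m`. -/
theorem exists_homoclinic {m lo hi B K : ℝ} {g g' R R' N : ℝ → ℝ} (hm : 0 < m) (hlo : 0 < lo)
    (hg : ∀ v ∈ Ioc 0 m, HasDerivAt g (g' v) v) (hg'c : ContinuousOn g' (Ioc 0 m))
    (hg' : ∀ v ∈ Ioc 0 m, 0 < g' v) (hR : ∀ v, HasDerivAt R (R' v) v)
    (hRpos : ∀ v ∈ Ioc 0 m, 0 < R v) (hRB : ∀ v ∈ Ioc 0 m, R v ≤ B)
    (hloR : ∀ v ∈ Ioc 0 m, lo * g' v ^ 2 ≤ m * R v)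
    (hRhi : ∀ v ∈ Ioc 0 m, m * R v ≤ hi * g' v ^ 2)
    (hN : ∀ v ∈ Ioc 0 m,
      2 * v * (m - v) * R v - v ^ 2 * R v + v ^ 2 * (m - v) * R' v = N v * g' v)
    (hNc : ContinuousOn N (Ioc 0 m)) (hgmono : MonotoneOn g (Ioc 0 m))
    (hgK : ∀ v ∈ Ioc 0 m, |g v| ≤ K * v) :
    ∃ v : ℝ → ℝ, Continuous v ∧ (∀ x, v x ∈ Ioc 0 m) ∧ MemH1rd (fun x => g (v x)) ∧
      ∃ U' : ℝ → ℝ, HasWeakDeriv (fun x => g (v x)) U' ∧ HasWeakDeriv U' (fun x => N (v x)) := by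
  set q : ℝ → ℝ := fun s => m * (Real.cosh s ^ 2)⁻¹ with hq
  have hqc : Continuous q :=
    continuous_const.mul (Continuous.inv₀ (by fun_prop) fun x => by positivity)
  have hqm : ∀ s, q s ∈ Ioc 0 m := by
    intro s
    refine ⟨by positivity, ?_⟩
    have : (Real.cosh s ^ 2)⁻¹ ≤ 1 := inv_le_one_of_one_le₀ (one_le_pow₀ (Real.one_le_cosh s))
    simpa [hq] using mul_le_mul_of_nonneg_left this hm.le
  have hRc : Continuous R := continuous_iff_continuousAt.2 fun x => (hR x).continuousAt
  set S : ℝ → ℝ := fun v => √(2 * m * R v) with hS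
  have hSpos : ∀ v ∈ Ioc 0 m, 0 < S v := fun v hv => by
    have := hRpos v hv
    simp only [hS]
    positivity
  have hS2 : ∀ v ∈ Ioc 0 m, S v ^ 2 = 2 * m * R v := fun v hv => by
    have := hRpos v hv
    exact Real.sq_sqrt (by positivity)
  set σ : ℝ → ℝ := fun s => S (q s) / (2 * g' (q s)) with hσ
  have hg'qc : Continuous fun s => g' (q s) := hg'c.comp_continuous hqc hqm
  have hσc : Continuous σ := by
    refine Continuous.div ?_ (continuous_const.mul hg'qc) fun s =>
      (mul_pos two_pos (hg' _ (hqm s))).ne'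
    simp only [hS]
    fun_prop
  have hσpos : ∀ s, 0 < σ s := fun s =>
    div_pos (hSpos _ (hqm s)) (mul_pos two_pos (hg' _ (hqm s)))
  have hσ2 : ∀ s, σ s ^ 2 * (2 * g' (q s) ^ 2) = m * R (q s) := by
    intro s
    have := (hg' _ (hqm s)).ne'
    simp only [hσ]
    rw [div_pow, hS2 _ (hqm s)]
    field_simp
  obtain ⟨θ, hθd, hθmono, hθodd, hθlow⟩ := exists_odd_solution (c := √(lo / 2)) (C := √(hi / 2))
    hσc (fun s => by simp [hσ, hq]) (by positivity)
    (fun s => by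
      rw [Real.sqrt_le_left (hσpos s).le]
      have h1 := hloR _ (hqm s)
      rw [← hσ2 s] at h1
      have h2 : 0 < g' (q s) ^ 2 := by have := hg' _ (hqm s); positivity
      nlinarith)
    (fun s => by
      apply Real.le_sqrt_of_sq_le
      have h1 := hRhi _ (hqm s)
      rw [← hσ2 s] at h1
      have h2 : 0 < g' (q s) ^ 2 := by have := hg' _ (hqm s); positivity
      nlinarith)
  have hθc : Continuous θ := continuous_iff_continuousAt.2 fun x => (hθd x).continuousAt
  have hθ0 : θ 0 = 0 := by have := hθodd 0; rw [neg_zero] at this; linarith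
  have hθabs : ∀ x, |θ x| = θ |x| := by
    intro x
    rcases le_total 0 x with hx | hx
    · rw [abs_of_nonneg hx, abs_of_nonneg]
      rw [← hθ0]; exact hθmono.monotone hx
    · rw [abs_of_nonpos hx, hθodd, abs_of_nonpos]
      rw [← hθ0]; exact hθmono.monotone hx
  set v : ℝ → ℝ := fun x => q (θ x) with hv
  set τ : ℝ → ℝ := fun x => Real.sinh (θ x) / Real.cosh (θ x) with hτ
  have hvc : Continuous v := hqc.comp hθc
  have hvm : ∀ x, v x ∈ Ioc 0 m := fun x => hqm _
  have hτc : Continuous τ := by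
    refine Continuous.div (by fun_prop) (by fun_prop) fun x => (Real.cosh_pos _).ne'
  have hvτ : ∀ x, v x = m * (1 - τ x ^ 2) := by
    intro x
    have h1 := Real.cosh_sq (θ x)
    have h2 := (Real.cosh_pos (θ x)).ne'
    simp only [hv, hq, hτ]
    field_simp
    linarith
  have hτd : ∀ x, HasDerivAt τ ((1 - τ x ^ 2) * σ (θ x)) x := by
    intro x
    have h2 := (Real.cosh_pos (θ x)).ne'
    refine (((hθd x).sinh).div ((hθd x).cosh) h2).congr_deriv ?_
    simp only [hτ]
    field_simp
  have hvd : ∀ x, HasDerivAt v (-2 * v x * τ x * σ (θ x)) x := by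
    intro x
    have h1 : HasDerivAt (fun x => m * (1 - τ x ^ 2))
        (m * (-(2 * τ x * ((1 - τ x ^ 2) * σ (θ x))))) x := by
      refine ((((hτd x).pow 2).const_sub 1).const_mul m).congr_deriv ?_
      simp
    rw [← funext hvτ] at h1
    refine h1.congr_deriv ?_
    rw [hvτ x]
    ring
  have hσv : ∀ x, σ (θ x) = S (v x) / (2 * g' (v x)) := fun x => rfl
  have hUd : ∀ x, HasDerivAt (fun x => g (v x)) (-(τ x * v x * S (v x))) x := by
    intro x
    have h1 := (hg' _ (hvm x)).ne'
    refine ((hg _ (hvm x)).comp x (hvd x)).congr_deriv ?_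
    rw [hσv]
    field_simp
  have hSc : Continuous fun x => S (v x) := by
    simp only [hS]
    fun_prop
  have hU'd : ∀ x, HasDerivAt (fun x => -(τ x * v x * S (v x))) (N (v x)) x := by
    intro x
    have h1 := (hg' _ (hvm x)).ne'
    have h2 := (hSpos _ (hvm x)).ne'
    have h3 := hRpos _ (hvm x)
    have hSd : HasDerivAt (fun x => S (v x))
        (2 * m * (R' (v x) * (-2 * v x * τ x * σ (θ x))) / (2 * S (v x))) x :=
      (((hR _).comp x (hvd x)).const_mul (2 * m)).sqrt (by positivity)
    refine ((((hτd x).mul (hvd x)).mul hSd).neg).congr_deriv ?_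
    have h4 := hN _ (hvm x)
    have h5 := hS2 _ (hvm x)
    have h6 : τ x ^ 2 = 1 - v x / m := by rw [hvτ x]; field_simp; ring
    have h7 : N (v x) = (2 * v x * (m - v x) * R (v x) - v x ^ 2 * R (v x)
      + v x ^ 2 * (m - v x) * R' (v x)) / g' (v x) := by rw [h4]; field_simp
    rw [h7, hσv]
    simp only [Pi.mul_apply]
    have h8 : ∀ t S r r' y p : ℝ, S ≠ 0 → p ≠ 0 → S ^ 2 = 2 * m * r → t ^ 2 = 1 - y / m →
      -((((1 - t ^ 2) * (S / (2 * p))) * y + t * (-2 * y * t * (S / (2 * p)))) * S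
        + t * y * (2 * m * (r' * (-2 * y * t * (S / (2 * p)))) / (2 * S)))
        = (2 * y * (m - y) * r - y ^ 2 * r + y ^ 2 * (m - y) * r') / p := by
      intro t S r r' y p hS0 hp hS2 ht
      have e1 : -((((1 - t ^ 2) * (S / (2 * p))) * y + t * (-2 * y * t * (S / (2 * p)))) * S
        + t * y * (2 * m * (r' * (-2 * y * t * (S / (2 * p)))) / (2 * S)))
        = (-((1 - t ^ 2) * y * S ^ 2) / 2 + t ^ 2 * y * S ^ 2 + m * r' * y ^ 2 * t ^ 2) / p := by
        field_simp
        ring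
      rw [e1, hS2, ht]
      field_simp
      ring
    exact h8 _ _ _ _ _ _ h2 h1 h5 h6
  have hU'c : Continuous fun x => -(τ x * v x * S (v x)) := by fun_prop
  have hUc : Continuous fun x => g (v x) :=
    continuous_iff_continuousAt.2 fun x => (hUd x).continuousAt
  have hvint : Integrable v :=
    (integrable_inv_cosh_sq (by positivity) hθc hθlow).const_mul m
  have hw := hasWeakDeriv_of_hasDerivAt hUd hU'c
  refine ⟨v, hvc, hvm, ⟨⟨?_, _, hw, ?_⟩, hUc, ?_, ?_⟩, _, hw,
    hasWeakDeriv_of_hasDerivAt hU'd (hNc.comp_continuous hvc hvm)⟩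
  · exact memLp_two_of_abs_le_mul hUc hvint (fun x => (hvm x).1.le) (fun x => (hvm x).2)
      fun x => hgK _ (hvm x)
  · refine memLp_two_of_abs_le_mul (K := √(2 * m * B)) hU'c hvint (fun x => (hvm x).1.le)
      (fun x => (hvm x).2) fun x => ?_
    have hτ1 : |τ x| ≤ 1 := by
      rw [← sq_le_one_iff_abs_le_one]
      have h1 := (hvm x).1
      rw [hvτ x] at h1
      have := pos_of_mul_pos_right h1 hm.le
      linarith
    have hSB : S (v x) ≤ √(2 * m * B) := by
      refine Real.sqrt_le_sqrt ?_
      have := hRB _ (hvm x)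
      gcongr
    rw [abs_neg, abs_mul, abs_mul, abs_of_pos (hvm x).1, abs_of_pos (hSpos _ (hvm x))]
    have h1 := (hvm x).1
    have h2 := hSpos _ (hvm x)
    calc |τ x| * v x * S (v x) ≤ 1 * v x * √(2 * m * B) := by gcongr
      _ = √(2 * m * B) * v x := by ring
  · intro x
    simp [hv, hq, hθodd]
  · intro x y hxy
    refine hgmono (hvm y) (hvm x) ?_
    simp only [hv, hq]
    have : Real.cosh (θ x) ≤ Real.cosh (θ y) := by
      rw [Real.cosh_le_cosh, hθabs, hθabs]
      exact hθmono.monotone hxy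
    gcongr

/-- On the curve `V = -v`, `α U ^ 2 = a v ^ 2 + b v ^ 3` the system reduces to one equation for `v`,
with energy `v ^ 2 (m - v) R v` up to a constant factor. -/
theorem exists_standingWave {ρ α a b m lo hi B : ℝ} {R R' : ℝ → ℝ} (hα : 0 < α)
    (ha : 0 ≤ a) (hb : 0 ≤ b) (hab : 0 < a + b) (hm : 0 < m) (hlo : 0 < lo)
    (hR : ∀ v, HasDerivAt R (R' v) v) (hRpos : ∀ v ∈ Ioc 0 m, 0 < R v)
    (hRB : ∀ v ∈ Ioc 0 m, R v ≤ B)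
    (hloR : ∀ v ∈ Ioc 0 m, lo * (2 * a + 3 * b * v) ^ 2 ≤ 4 * α * m * R v * (a + b * v))
    (hRhi : ∀ v ∈ Ioc 0 m, 4 * α * m * R v * (a + b * v) ≤ hi * (2 * a + 3 * b * v) ^ 2)
    (hN : ∀ v, 2 * v * (m - v) * R v - v ^ 2 * R v + v ^ 2 * (m - v) * R' v =
      (v ^ 2 * ((a + b * v) / α) + α * (ρ - v)) * (v * (2 * a + 3 * b * v) / (2 * α))) :
    ∃ v : ℝ → ℝ, (∀ x, 0 < v x) ∧
      IsStandingWave ρ α a b (fun x => v x * √((a + b * v x) / α)) (fun x => -v x) ∧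
      MemH1rd (fun x => v x * √((a + b * v x) / α)) := by
  have hw : ∀ v ∈ Ioc 0 m, 0 < a + b * v := by
    intro v hv
    rcases ha.eq_or_lt with rfl | ha
    · have := mul_pos (by linarith : 0 < b) hv.1
      linarith
    · have := mul_nonneg hb hv.1.le
      linarith
  have hw' : ∀ v ∈ Ioc 0 m, 0 < 2 * a + 3 * b * v := by
    intro v hv
    have := hw v hv
    have := mul_nonneg hb hv.1.le
    linarith
  have hs : ∀ v ∈ Ioc 0 m, 0 < √((a + b * v) / α) := fun v hv =>
    Real.sqrt_pos.2 (div_pos (hw v hv) hα)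
  have hs2 : ∀ v ∈ Ioc 0 m, √((a + b * v) / α) ^ 2 = (a + b * v) / α := fun v hv =>
    Real.sq_sqrt (div_pos (hw v hv) hα).le
  have hg'2 : ∀ v ∈ Ioc 0 m, ((2 * a + 3 * b * v) / (2 * α * √((a + b * v) / α))) ^ 2 =
      (2 * a + 3 * b * v) ^ 2 / (4 * α * (a + b * v)) := by
    intro v hv
    rw [div_pow, mul_pow, hs2 v hv]
    congr 1
    field_simp
    ring
  obtain ⟨v, hvc, hvm, hH1, U', hU', hU''⟩ := exists_homoclinic (m := m) (lo := lo) (hi := hi)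
    (B := B) (K := √((a + b * m) / α)) (g := fun v => v * √((a + b * v) / α))
    (g' := fun v => (2 * a + 3 * b * v) / (2 * α * √((a + b * v) / α))) (R := R) (R' := R')
    (N := fun v => (v * √((a + b * v) / α)) ^ 3 + α * (-v + ρ) * (v * √((a + b * v) / α)))
    hm hlo
    (by
      intro v hv
      have h1 : HasDerivAt (fun v => (a + b * v) / α) (b / α) v := by
        simpa using (((hasDerivAt_id v).const_mul b).const_add a).div_const α
      refine ((hasDerivAt_id v).mul (h1.sqrt (div_pos (hw v hv) hα).ne')).congr_deriv ?_
      have h2 := (hs v hv).ne'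
      have h3 := hs2 v hv
      have h4 : a + b * v = α * √((a + b * v) / α) ^ 2 := by rw [h3]; field_simp
      have h5 : ∀ t : ℝ, t ≠ 0 → a + b * v = α * t ^ 2 →
          1 * t + v * (b / α / (2 * t)) = (2 * a + 3 * b * v) / (2 * α * t) := by
        intro t ht h
        field_simp
        linarith
      exact h5 _ h2 h4)
    (by
      refine ContinuousOn.div (by fun_prop) (by fun_prop) fun v hv => ?_
      have := hs v hv
      positivity)
    (fun v hv => by
      have := hs v hv
      have := hw' v hv
      positivity)
    hR hRpos hRB
    (fun v hv => by
      have := hw v hv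
      rw [hg'2 v hv, mul_div_assoc', div_le_iff₀ (by positivity)]
      linarith [hloR v hv])
    (fun v hv => by
      have := hw v hv
      rw [hg'2 v hv, mul_div_assoc', le_div_iff₀ (by positivity)]
      linarith [hRhi v hv])
    (fun v hv => by
      have h1 := (hs v hv).ne'
      have h2 := hs2 v hv
      rw [hN v]
      generalize √((a + b * v) / α) = t at h1 h2 ⊢
      rw [← h2]
      field_simp
      ring)
    (by fun_prop)
    (by
      intro v hv w hw' hvw
      have := hv.1.le
      have := this.trans hvw
      dsimp only
      gcongr)
    (fun v hv => by
      have := hs v hv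
      rw [abs_of_pos (mul_pos hv.1 this), mul_comm]
      have := hv.1.le
      have := hv.2
      gcongr)
  have hsq : ∀ x, a * (-v x) ^ 2 - b * (-v x) ^ 3 = α * (v x * √((a + b * v x) / α)) ^ 2 := by
    intro x
    rw [mul_pow, hs2 _ (hvm x)]
    field_simp
    ring
  refine ⟨v, fun x => (hvm x).1, ⟨⟨U', hU', hU''⟩, ?_, ?_, fun φ _ _ => ?_⟩, hH1⟩
  · exact Continuous.locallyIntegrable (by fun_prop)
  · exact Continuous.locallyIntegrable (by fun_prop)
  · rw [← integral_const_mul]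
    refine integral_congr_ae (Filter.Eventually.of_forall fun x => ?_)
    dsimp only
    rw [hsq x]
    ring

theorem exists_standingWave_cubic (ρ α : ℝ) (hρ : 0 < ρ) (hα : 0 < α) :
    ∃ b : ℝ, 0 < b ∧ ∃ U V : ℝ → ℝ, IsStandingWave ρ α 0 b U V ∧
      MemH1rd U ∧ (∀ x, 0 < U x) ∧
      ∀ x, V x = -((α / b) ^ (1 / 3 : ℝ) * U x ^ (2 / 3 : ℝ)) := by
  have hb : 0 < 2 * α ^ 2 / (27 * ρ ^ 2) := by positivity
  set b := 2 * α ^ 2 / (27 * ρ ^ 2) with hbdef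
  set m := 3 * ρ / 2 with hmdef
  have hm : 0 < m := by positivity
  have hρm : ρ = 2 * m / 3 := by rw [hmdef]; ring
  have hT : ∀ v ∈ Ioc 0 m, 1 / 4 ≤ 3 / 8 - (v ^ 2 + v * m + m ^ 2) / (54 * ρ ^ 2) ∧
      3 / 8 - (v ^ 2 + v * m + m ^ 2) / (54 * ρ ^ 2) ≤ 3 / 8 := by
    intro v hv
    have hv1 := hv.1
    refine ⟨?_, sub_le_self _ (by positivity)⟩
    rw [le_sub_comm, div_le_iff₀ (by positivity), hρm]
    nlinarith [mul_nonneg hv1.le (sub_nonneg.2 hv.2), mul_nonneg hm.le (sub_nonneg.2 hv.2)]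
  obtain ⟨v, hv, hS, hH⟩ := exists_standingWave (ρ := ρ) (α := α) (a := 0) (b := b) (m := m)
    (lo := α * m / 9) (hi := α * m / 6) (B := b * m * (3 / 8))
    (R := fun v => b * v * (3 / 8 - (v ^ 2 + v * m + m ^ 2) / (54 * ρ ^ 2)))
    (R' := fun v => b * (3 / 8 - (v ^ 2 + v * m + m ^ 2) / (54 * ρ ^ 2))
      + b * v * (-((2 * v + m) / (54 * ρ ^ 2))))
    hα le_rfl hb.le (by linarith) hm (by positivity)
    (fun v => by
      have h1 := ((((hasDerivAt_pow 2 v).add ((hasDerivAt_id v).mul_const m)).add_const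
        (m ^ 2)).div_const (54 * ρ ^ 2)).const_sub (3 / 8)
      refine (((hasDerivAt_id v).const_mul b).mul h1).congr_deriv ?_
      simp)
    (fun v hv => by
      have := hT v hv
      have := hv.1
      exact mul_pos (by positivity) (by linarith))
    (fun v hv => by
      obtain ⟨h1, h2⟩ := hT v hv
      exact mul_le_mul (by gcongr; exact hv.2) h2 (by linarith) (by positivity))
    (fun v hv => by
      have h1 := (hT v hv).1
      have h2 : 0 ≤ α * m * (b * v) ^ 2 := by positivity
      nlinarith)
    (fun v hv => by
      have h1 := (hT v hv).2
      have h2 : 0 ≤ α * m * (b * v) ^ 2 := by positivity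
      nlinarith)
    (fun v => by
      rw [hbdef, hmdef]
      field_simp
      ring)
  have hU : ∀ x, 0 < v x * √((0 + b * v x) / α) := fun x => by
    have := hv x
    positivity
  refine ⟨b, hb, _, _, hS, hH, hU, fun x => ?_⟩
  have h0 := hv x
  have h1 : (v x * √((0 + b * v x) / α)) ^ (2 / 3 : ℝ) = (b / α) ^ (1 / 3 : ℝ) * v x := by
    have e : (v x * √((0 + b * v x) / α)) ^ 2 = b / α * v x ^ 3 := by
      rw [mul_pow, Real.sq_sqrt (by positivity)]
      ring
    have e3 : (v x ^ 3) ^ (1 / 3 : ℝ) = v x := by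
      rw [← Real.rpow_natCast, ← Real.rpow_mul h0.le]
      norm_num
    rw [show (2 / 3 : ℝ) = (2 : ℕ) * (1 / 3 : ℝ) by norm_num, Real.rpow_mul (hU x).le,
      Real.rpow_natCast, e, Real.mul_rpow (by positivity) (by positivity), e3]
  rw [h1, ← mul_assoc, ← Real.mul_rpow (by positivity) (by positivity)]
  have : α / b * (b / α) = 1 := by field_simp
  rw [this, Real.one_rpow, one_mul]

theorem exists_standingWave_quadratic (ρ α : ℝ) (hρ : 0 < ρ) (hα : 0 < α) :
    ∃ a : ℝ, 0 < a ∧ ∃ U V : ℝ → ℝ, IsStandingWave ρ α a 0 U V ∧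
      MemH1rd U ∧ (∀ x, 0 < U x) ∧
      ∀ x, V x = -((α / a) ^ (1 / 2 : ℝ) * U x) := by
  have ha : 0 < α ^ 2 / (6 * ρ) := by positivity
  set a := α ^ 2 / (6 * ρ) with hadef
  have hT : ∀ v ∈ Ioc 0 (2 * ρ), 1 / 6 ≤ 1 / 3 - (v + 2 * ρ) / (24 * ρ) ∧
      1 / 3 - (v + 2 * ρ) / (24 * ρ) ≤ 1 / 4 := by
    intro v hv
    have hv1 := hv.1
    have hv2 := hv.2
    constructor
    · rw [le_sub_comm, div_le_iff₀ (by positivity)]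
      linarith
    · rw [sub_le_comm, le_div_iff₀ (by positivity)]
      linarith
  obtain ⟨v, hv, hS, hH⟩ := exists_standingWave (ρ := ρ) (α := α) (a := a) (b := 0) (m := 2 * ρ)
    (lo := α * (2 * ρ) / 6) (hi := α * (2 * ρ) / 4) (B := a * (1 / 4))
    (R := fun v => a * (1 / 3 - (v + 2 * ρ) / (24 * ρ)))
    (R' := fun _ => a * (-(1 / (24 * ρ))))
    hα ha.le le_rfl (by linarith) (by positivity) (by positivity)
    (fun v => ((((hasDerivAt_id v).add_const (2 * ρ)).div_const (24 * ρ)).const_sub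
        (1 / 3)).const_mul a)
    (fun v hv => by
      have := hT v hv
      exact mul_pos (by positivity) (by linarith))
    (fun v hv => by
      have := hT v hv
      gcongr
      exact this.2)
    (fun v hv => by
      have h1 := (hT v hv).1
      have h2 : 0 ≤ α * (2 * ρ) * a ^ 2 := by positivity
      nlinarith)
    (fun v hv => by
      have h1 := (hT v hv).2
      have h2 : 0 ≤ α * (2 * ρ) * a ^ 2 := by positivity
      nlinarith)
    (fun v => by
      rw [hadef]
      field_simp
      ring)
  have hU : ∀ x, 0 < v x * √((a + 0 * v x) / α) := fun x => by
    have := hv x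
    rw [zero_mul, add_zero]
    positivity
  refine ⟨a, ha, _, _, hS, hH, hU, fun x => ?_⟩
  rw [← Real.sqrt_eq_rpow, zero_mul, add_zero, mul_left_comm, ← Real.sqrt_mul (by positivity)]
  have : α / a * (a / α) = 1 := by field_simp
  rw [this, Real.sqrt_one, mul_one]

theorem exists_standingWave_mixed (ρ α : ℝ) (hρ : 0 < ρ) (hα : 0 < α) :
    ∃ a b : ℝ, 0 < a ∧ 0 < b ∧ ∃ U V : ℝ → ℝ, IsStandingWave ρ α a b U V ∧
      MemH1rd U ∧ (∀ x, 0 < U x) ∧ (∀ x, V x < 0) ∧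
      ∀ x, a * V x ^ 2 - b * V x ^ 3 = α * U x ^ 2 := by
  have ha : 0 < 2 * α ^ 2 / (75 * ρ) := by positivity
  set a := 2 * α ^ 2 / (75 * ρ) with hadef
  have hb : 0 < a / ρ := by positivity
  set Q : ℝ → ℝ := fun v =>
    200 + 200 * (v / ρ) - 14 * (v / ρ) ^ 2 - 4 * (v / ρ) ^ 3 with hQ
  have hs : ∀ v ∈ Ioc 0 (3 * ρ / 2), 0 < v / ρ ∧ v / ρ ≤ 3 / 2 := by
    intro v hv
    refine ⟨div_pos hv.1 hρ, ?_⟩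
    rw [div_le_iff₀ hρ]
    linarith [hv.2]
  have hT : ∀ v ∈ Ioc 0 (3 * ρ / 2), 200 ≤ Q v ∧ Q v ≤ 500 := by
    intro v hv
    obtain ⟨h1, h2⟩ := hs v hv
    simp only [hQ]
    generalize v / ρ = s at h1 h2
    have h3 : s ^ 2 ≤ 3 / 2 * s := by nlinarith
    have h4 : s ^ 3 ≤ 9 / 4 * s := by nlinarith
    constructor
    · linarith
    · have : 0 ≤ s ^ 2 := by positivity
      have : 0 ≤ s ^ 3 := by positivity
      linarith
  obtain ⟨v, hv, hS, hH⟩ := exists_standingWave (ρ := ρ) (α := α) (a := a) (b := a / ρ)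
    (m := 3 * ρ / 2)
    (lo := α * (3 * ρ / 2) / 40) (hi := 3 * (α * (3 * ρ / 2))) (B := a / 600 * 500)
    (R := fun v => a / 600 * Q v)
    (R' := fun v => a / 600 *
      (200 * (1 / ρ) - 14 * (2 * (v / ρ) * (1 / ρ)) - 4 * (3 * (v / ρ) ^ 2 * (1 / ρ))))
    hα ha.le hb.le (by linarith) (by positivity) (by positivity)
    (fun v => by
      have h1 : HasDerivAt (fun v => v / ρ) (1 / ρ) v := (hasDerivAt_id v).div_const ρ
      refine HasDerivAt.const_mul _ ?_
      refine ((((h1.const_mul 200).const_add 200).sub ((h1.pow 2).const_mul 14)).sub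
        ((h1.pow 3).const_mul 4)).congr_deriv ?_
      norm_num)
    (fun v hv => by
      have := hT v hv
      exact mul_pos (by positivity) (by linarith))
    (fun v hv => by
      have := hT v hv
      gcongr
      exact this.2)
    (fun v hv => by
      obtain ⟨h1, h2⟩ := hs v hv
      have h3 := (hT v hv).1
      have e1 : 2 * a + 3 * (a / ρ) * v = a * (2 + 3 * (v / ρ)) := by ring
      have e2 : a + a / ρ * v = a * (1 + v / ρ) := by ring
      rw [e1, e2]
      generalize v / ρ = s at *
      calc α * (3 * ρ / 2) / 40 * (a * (2 + 3 * s)) ^ 2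
          = α * (3 * ρ / 2) * a ^ 2 * ((2 + 3 * s) ^ 2 / 40) := by ring
        _ ≤ α * (3 * ρ / 2) * a ^ 2 * (200 * (1 + 0) / 150) := by
            refine mul_le_mul_of_nonneg_left ?_ (by positivity)
            nlinarith
        _ ≤ α * (3 * ρ / 2) * a ^ 2 * (Q v * (1 + s) / 150) := by gcongr
        _ = 4 * α * (3 * ρ / 2) * (a / 600 * Q v) * (a * (1 + s)) := by ring)
    (fun v hv => by
      obtain ⟨h1, h2⟩ := hs v hv
      have h3 := (hT v hv).2
      have e1 : 2 * a + 3 * (a / ρ) * v = a * (2 + 3 * (v / ρ)) := by ring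
      have e2 : a + a / ρ * v = a * (1 + v / ρ) := by ring
      rw [e1, e2]
      generalize v / ρ = s at *
      calc 4 * α * (3 * ρ / 2) * (a / 600 * Q v) * (a * (1 + s))
          = α * (3 * ρ / 2) * a ^ 2 * (Q v * (1 + s) / 150) := by ring
        _ ≤ α * (3 * ρ / 2) * a ^ 2 * (500 * (1 + s) / 150) := by gcongr
        _ ≤ α * (3 * ρ / 2) * a ^ 2 * (3 * (2 + 3 * s) ^ 2) := by
            refine mul_le_mul_of_nonneg_left ?_ (by positivity)
            nlinarith
        _ = 3 * (α * (3 * ρ / 2)) * (a * (2 + 3 * s)) ^ 2 := by ring)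
    (fun v => by
      simp only [hQ]
      rw [hadef]
      field_simp
      ring)
  have hw : ∀ x, 0 < (a + a / ρ * v x) / α := fun x => by
    have := hv x
    positivity
  refine ⟨a, a / ρ, ha, hb, _, _, hS, hH, fun x => mul_pos (hv x) (Real.sqrt_pos.2 (hw x)),
    fun x => neg_neg_of_pos (hv x), fun x => ?_⟩
  rw [mul_pow, Real.sq_sqrt (hw x).le]
  field_simp
  ring

theorem theorem3 (ρ α : ℝ) (hρ : 0 < ρ) (hα : 0 < α) :
    (∃ b : ℝ, 0 < b ∧ ∃ U V : ℝ → ℝ, IsStandingWave ρ α 0 b U V ∧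
      MemH1rd U ∧ (∀ x, 0 < U x) ∧
      ∀ x, V x = -((α / b) ^ (1 / 3 : ℝ) * U x ^ (2 / 3 : ℝ))) ∧
    (∃ a : ℝ, 0 < a ∧ ∃ U V : ℝ → ℝ, IsStandingWave ρ α a 0 U V ∧
      MemH1rd U ∧ (∀ x, 0 < U x) ∧
      ∀ x, V x = -((α / a) ^ (1 / 2 : ℝ) * U x)) ∧
    (∃ a b : ℝ, 0 < a ∧ 0 < b ∧ ∃ U V : ℝ → ℝ, IsStandingWave ρ α a b U V ∧
      MemH1rd U ∧ (∀ x, 0 < U x) ∧ (∀ x, V x < 0) ∧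
      ∀ x, a * V x ^ 2 - b * V x ^ 3 = α * U x ^ 2) :=
  ⟨exists_standingWave_cubic ρ α hρ hα, exists_standingWave_quadratic ρ α hρ hα,
    exists_standingWave_mixed ρ α hρ hα⟩
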